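/- For real $z$ and $U$ let $P(z)=\prod_{p<z}p$ (product over primes) and let $\mathcal U_z(U)=\{u\in\mathbb Z : 1\le u\le U,\ \gcd(u,P(z))=1\}$. For a prime $q$, a real number $z$ and integers $M,N,U$, let $I(z,M,N,U)$ be the number of solutions of the congruence $$n_1u_1\equiv n_2u_2 \pmod q$$ in integers $M<n_1,n_2\le M+N$ and $u_1,u_2\in\mathcal U_z(U)$. There is a real number $0<A_0<1/2$ such that for every real $A$ with $0<A\le A_0$ there is a constant $C>0$, depending only on $A$, with the following property: for every prime $q$, all integers $M,N,U$ with $U\le N$ and $UN\le q$, and every real $z$ with $1<z\le U^A$, $$I(z,M,N,U)\le C\,N\,|\mathcal U_z(U)|\left(1+\frac{\log U}{(\log z)^2}\right).$$ -/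

import Mathlib

/-- `P(z) = ∏_{p < z} p`, the product of the primes below the real number `z`. -/
noncomputable def primeProdBelow (z : ℝ) : ℕ :=
  ∏ p ∈ (Finset.range ⌈z⌉₊).filter Nat.Prime, p

/-- `𝒰_z(U) = {1 ≤ u ≤ U : (u, P(z)) = 1}` for real `U` and `z`. -/
noncomputable def roughNumbers (z U : ℝ) : Finset ℕ :=
  (Finset.Icc 1 ⌊U⌋₊).filter fun u => Nat.gcd u (primeProdBelow z) = 1

/-- `I(z, M, N, U)`: the number of quadruples `((n₁, n₂), (u₁, u₂))` of integers with
`M < n₁, n₂ ≤ M + N`, `u₁, u₂ ∈ 𝒰_z(U)` and `n₁ u₁ ≡ n₂ u₂ (mod q)`. -/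
noncomputable def multCongCount (q : ℕ) (z : ℝ) (M N U : ℤ) : ℕ :=
  (((Finset.Ioc M (M + N) ×ˢ Finset.Ioc M (M + N)) ×ˢ
      (roughNumbers z (U : ℝ) ×ˢ roughNumbers z (U : ℝ))).filter fun x =>
    x.1.1 * (x.2.1 : ℤ) ≡ x.1.2 * (x.2.2 : ℤ) [ZMOD (q : ℤ)]).card

/-- The primes in the product are exactly those with `p < z`. -/
theorem mem_primes_primeProdBelow {z : ℝ} {p : ℕ} :
    p ∈ (Finset.range ⌈z⌉₊).filter Nat.Prime ↔ (p : ℝ) < z ∧ p.Prime := by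
  simp [Nat.lt_ceil]

theorem mem_roughNumbers {z U : ℝ} {u : ℕ} :
    u ∈ roughNumbers z U ↔
      (1 ≤ u ∧ (u : ℝ) ≤ U) ∧ Nat.gcd u (primeProdBelow z) = 1 := by
  unfold roughNumbers
  rw [Finset.mem_filter, Finset.mem_Icc]
  constructor
  · rintro ⟨⟨h1, h2⟩, h3⟩
    exact ⟨⟨h1, (Nat.le_floor_iff' (by omega)).1 h2⟩, h3⟩
  · rintro ⟨⟨h1, h2⟩, h3⟩
    exact ⟨⟨h1, (Nat.le_floor_iff' (by omega)).2 h2⟩, h3⟩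

theorem sum_log_div_primesBelow_le {n : ℕ} (hn : 1 ≤ n) :
    ∑ p ∈ (n + 1).primesBelow, Real.log p / p ≤ Real.log n + Real.log 4 := by
  have hdvd : ∏ p ∈ (n + 1).primesBelow, p ^ (n / p) ∣ n.factorial := by
    refine Finset.prod_dvd_of_isRelPrime ?_ ?_
    · intro p hp r hr hpr
      have hp' := Nat.prime_of_mem_primesBelow hp
      have hr' := Nat.prime_of_mem_primesBelow hr
      rw [Function.onFun, ← Nat.coprime_iff_isRelPrime]
      exact Nat.Coprime.pow _ _ ((Nat.coprime_primes hp' hr').2 hpr)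
    · intro p hp
      have hp' := Nat.prime_of_mem_primesBelow hp
      rw [hp'.pow_dvd_factorial_iff (Nat.lt_succ_self _)]
      rcases Nat.lt_or_ge n p with h | h
      · simp [Nat.div_eq_of_lt h]
      · calc n / p = n / p ^ 1 := by simp
          _ ≤ _ := Finset.single_le_sum (f := fun i => n / p ^ i) (fun _ _ => Nat.zero_le _)
            (Finset.mem_Ico.2 ⟨le_rfl, by
              have := Nat.log_pos hp'.one_lt h
              omega⟩)
  have h1 : ∑ p ∈ (n + 1).primesBelow, ((n / p : ℕ) : ℝ) * Real.log p ≤ n * Real.log n := by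
    have hle := (Nat.le_of_dvd (Nat.factorial_pos n) hdvd).trans (Nat.factorial_le_pow n)
    have hle' : (∏ p ∈ (n + 1).primesBelow, (p : ℝ) ^ (n / p)) ≤ (n : ℝ) ^ n := by
      exact_mod_cast hle
    have hpos : ∀ p ∈ (n + 1).primesBelow, (p : ℝ) ^ (n / p) ≠ 0 := fun p hp =>
      pow_ne_zero _ (Nat.cast_ne_zero.2 (Nat.prime_of_mem_primesBelow hp).ne_zero)
    have := Real.log_le_log (Finset.prod_pos fun p hp =>
      lt_of_le_of_ne (by positivity) (hpos p hp).symm) hle'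
    rw [Real.log_prod hpos, Real.log_pow] at this
    simpa [Real.log_pow] using this
  have h2 : ∑ p ∈ (n + 1).primesBelow, Real.log p ≤ Real.log 4 * n := by
    have := Chebyshev.theta_le_log4_mul_x (x := (n : ℝ)) (by positivity)
    rw [Chebyshev.theta_eq_sum_primesLE_log] at this
    simpa [Nat.primesLE] using this
  have hn0 : (0 : ℝ) < n := by exact_mod_cast hn
  have h3 : n * ∑ p ∈ (n + 1).primesBelow, Real.log p / p ≤
      ∑ p ∈ (n + 1).primesBelow, (((n / p : ℕ) : ℝ) * Real.log p + Real.log p) := by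
    rw [Finset.mul_sum]
    refine Finset.sum_le_sum fun p hp => ?_
    have hp' := Nat.prime_of_mem_primesBelow hp
    have hlog : 0 ≤ Real.log p := Real.log_natCast_nonneg p
    have hfl : (n : ℝ) / p ≤ (n / p : ℕ) + 1 := by
      rw [← Nat.floor_div_eq_div (K := ℝ)]
      exact (Nat.lt_floor_add_one _).le
    calc (n : ℝ) * (Real.log p / p) = n / p * Real.log p := by ring
      _ ≤ ((n / p : ℕ) + 1) * Real.log p := by gcongr
      _ = _ := by ring
  rw [Finset.sum_add_distrib] at h3
  have h4 : n * ∑ p ∈ (n + 1).primesBelow, Real.log p / p ≤ n * (Real.log n + Real.log 4) := by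
    linarith
  exact le_of_mul_le_mul_left h4 hn0

theorem sum_range_rpow_neg_le {δ : ℝ} (hδ : 0 < δ) (n : ℕ) :
    ∑ i ∈ Finset.range n, ((i + 1 : ℕ) : ℝ) ^ (-(1 + δ)) ≤ 1 + 1 / δ := by
  suffices h : ∀ n : ℕ, ∑ i ∈ Finset.range (n + 1), ((i + 1 : ℕ) : ℝ) ^ (-(1 + δ)) ≤
      1 + 1 / δ - ((n + 1 : ℕ) : ℝ) ^ (-δ) / δ by
    rcases n with _ | n
    · simp; positivity
    · refine (h n).trans ?_
      have : 0 ≤ ((n + 1 : ℕ) : ℝ) ^ (-δ) / δ := by positivity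
      linarith
  intro n
  induction n with
  | zero => simp
  | succ n ih =>
    rw [Finset.sum_range_succ]
    have ha : (0 : ℝ) < ((n + 1 : ℕ) : ℝ) := by positivity
    have hb : (0 : ℝ) < ((n + 1 + 1 : ℕ) : ℝ) := by positivity
    set a : ℝ := ((n + 1 : ℕ) : ℝ) with ha'
    set b : ℝ := ((n + 1 + 1 : ℕ) : ℝ) with hb'
    have hab : a = b - 1 := by simp [ha', hb']
    have key : b ^ (-δ) * (1 + δ / b) ≤ a ^ (-δ) := by
      have h1 : Real.log (a / b) ≤ -(1 / b) := by
        have := Real.log_le_sub_one_of_pos (div_pos ha hb)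
        have h' : a / b - 1 = -(1 / b) := by rw [hab]; field_simp; ring
        linarith
      have h2 : a ^ (-δ) = b ^ (-δ) * Real.exp (-δ * Real.log (a / b)) := by
        rw [Real.rpow_def_of_pos ha, Real.rpow_def_of_pos hb, ← Real.exp_add,
          Real.log_div ha.ne' hb.ne']
        congr 1; ring
      rw [h2]
      gcongr
      have h3 := Real.add_one_le_exp (-δ * Real.log (a / b))
      have h4 : δ / b ≤ -δ * Real.log (a / b) := by
        have := mul_le_mul_of_nonneg_left h1 hδ.le
        have e : δ / b = δ * (1 / b) := by ring
        linarith
      linarith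
    have e1 : b ^ (-(1 + δ)) = b ^ (-δ) / b := by
      rw [show -(1 + δ) = -δ - 1 by ring, Real.rpow_sub_one hb.ne']
    rw [e1]
    have e2 : b ^ (-δ) / b + b ^ (-δ) / δ = b ^ (-δ) * (1 + δ / b) / δ := by
      field_simp
      ring
    have e3 : b ^ (-δ) * (1 + δ / b) / δ ≤ a ^ (-δ) / δ := by gcongr
    linarith

/-- The completely multiplicative function `n ↦ n ^ (-s)` on the natural numbers. -/
noncomputable def natRpowNegHom (s : ℝ) : ℕ →* ℝ where
  toFun n := (n : ℝ) ^ (-s)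
  map_one' := by simp
  map_mul' a b := by
    rw [Nat.cast_mul, Real.mul_rpow (by positivity) (by positivity)]

theorem natRpowNegHom_apply (s : ℝ) (n : ℕ) : natRpowNegHom s n = (n : ℝ) ^ (-s) := rfl

theorem natRpowNegHom_prime_lt_one {s : ℝ} (hs : 0 < s) {p : ℕ} (hp : p.Prime) :
    ‖natRpowNegHom s p‖ < 1 := by
  rw [natRpowNegHom_apply, Real.norm_of_nonneg (by positivity)]
  exact Real.rpow_lt_one_of_one_lt_of_neg (by exact_mod_cast hp.one_lt) (by linarith)

theorem prod_primesBelow_rpow_le {δ : ℝ} (hδ : 0 < δ) (N : ℕ) :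
    ∏ p ∈ N.primesBelow, (1 - (p : ℝ) ^ (-(1 + δ)))⁻¹ ≤ 1 + 1 / δ := by
  have h := EulerProduct.summable_and_hasSum_smoothNumbers_prod_primesBelow_geometric
    (f := natRpowNegHom (1 + δ)) (fun hp => natRpowNegHom_prime_lt_one (by linarith) hp) N
  refine hasSum_le_of_sum_le h.2 fun s => ?_
  obtain ⟨B, hB⟩ := (s.image Subtype.val).bddAbove
  have hsub : s.image (fun m : N.smoothNumbers => (m : ℕ) - 1) ⊆ Finset.range B := by
    intro i hi
    obtain ⟨m, hm, rfl⟩ := Finset.mem_image.1 hi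
    have h1 : (m : ℕ) ≤ B := hB (Finset.mem_coe.2 (Finset.mem_image_of_mem _ hm))
    have h2 : (m : ℕ) ≠ 0 := Nat.ne_zero_of_mem_smoothNumbers m.2
    rw [Finset.mem_range]
    omega
  calc ∑ m ∈ s, natRpowNegHom (1 + δ) m
      = ∑ m ∈ s, (((m : ℕ) - 1 + 1 : ℕ) : ℝ) ^ (-(1 + δ)) := by
        refine Finset.sum_congr rfl fun m _ => ?_
        have h2 : (m : ℕ) ≠ 0 := Nat.ne_zero_of_mem_smoothNumbers m.2
        rw [natRpowNegHom_apply, Nat.sub_add_cancel (by omega)]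
    _ = ∑ i ∈ s.image (fun m : N.smoothNumbers => (m : ℕ) - 1),
          ((i + 1 : ℕ) : ℝ) ^ (-(1 + δ)) := by
        rw [Finset.sum_image]
        intro a _ b _ hab
        have h2 : (a : ℕ) ≠ 0 := Nat.ne_zero_of_mem_smoothNumbers a.2
        have h3 : (b : ℕ) ≠ 0 := Nat.ne_zero_of_mem_smoothNumbers b.2
        have hab' : (a : ℕ) - 1 = b - 1 := hab
        exact Subtype.ext (by omega)
    _ ≤ ∑ i ∈ Finset.range B, ((i + 1 : ℕ) : ℝ) ^ (-(1 + δ)) :=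
        Finset.sum_le_sum_of_subset_of_nonneg hsub fun _ _ _ => by positivity
    _ ≤ _ := sum_range_rpow_neg_le hδ B

/-- The upper bound in Mertens' third theorem. -/
theorem exists_prod_primesBelow_le :
    ∃ C : ℝ, 0 < C ∧ ∀ N : ℕ, 2 ≤ N →
      ∏ p ∈ N.primesBelow, (1 - (p : ℝ)⁻¹)⁻¹ ≤ C * Real.log N := by
  refine ⟨Real.exp (2 * (1 + Real.log 4 / Real.log 2)) * (1 + 1 / Real.log 2),
    by positivity, fun N hN => ?_⟩
  have hlog2 : 0 < Real.log 2 := Real.log_pos one_lt_two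
  have hlogN : Real.log 2 ≤ Real.log N :=
    Real.log_le_log two_pos (by exact_mod_cast hN)
  have hlogN0 : 0 < Real.log N := hlog2.trans_le hlogN
  set δ : ℝ := 1 / Real.log N with hδdef
  have hδ : 0 < δ := by positivity
  have hcomp : ∀ p ∈ N.primesBelow, (1 - (p : ℝ)⁻¹)⁻¹ ≤
      Real.exp (2 * (δ * (Real.log p / p))) * (1 - (p : ℝ) ^ (-(1 + δ)))⁻¹ := by
    intro p hp
    have hp' := Nat.prime_of_mem_primesBelow hp
    have hp2 : (2 : ℝ) ≤ p := by exact_mod_cast hp'.two_le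
    have hp0 : (0 : ℝ) < p := by linarith
    have hinv : (p : ℝ)⁻¹ ≤ 1 / 2 := by
      rw [inv_eq_one_div]; exact one_div_le_one_div_of_le two_pos hp2
    have hlt := natRpowNegHom_prime_lt_one (s := 1 + δ) (by linarith) hp'
    rw [natRpowNegHom_apply, Real.norm_of_nonneg (by positivity)] at hlt
    have hpos : 0 < 1 - (p : ℝ) ^ (-(1 + δ)) := by linarith
    have hpos' : 0 < 1 - (p : ℝ)⁻¹ := by linarith
    have e : (p : ℝ) ^ (-(1 + δ)) = (p : ℝ)⁻¹ * Real.exp (-(δ * Real.log p)) := by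
      rw [Real.rpow_def_of_pos hp0, show Real.log p * -(1 + δ) =
        -Real.log p + -(δ * Real.log p) by ring, Real.exp_add, Real.exp_neg (Real.log p),
        Real.exp_log hp0]
    have h1 := Real.add_one_le_exp (-(δ * Real.log p))
    have h2 := Real.add_one_le_exp (2 * (δ * (Real.log p / p)))
    set t := δ * (Real.log p / p) with ht
    have ht0 : 0 ≤ t := by
      have := Real.log_natCast_nonneg p
      positivity
    have hge : (p : ℝ)⁻¹ - t ≤ (p : ℝ) ^ (-(1 + δ)) := by
      rw [e]
      have := mul_le_mul_of_nonneg_left h1 (inv_nonneg.2 hp0.le)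
      have e2 : (p : ℝ)⁻¹ * (-(δ * Real.log p) + 1) = (p : ℝ)⁻¹ - t := by rw [ht]; ring
      linarith
    rw [← div_eq_mul_inv, le_div_iff₀ hpos, inv_mul_le_iff₀ hpos']
    calc 1 - (p : ℝ) ^ (-(1 + δ)) ≤ (1 - (p : ℝ)⁻¹) + t := by linarith
      _ ≤ (1 - (p : ℝ)⁻¹) * (2 * t + 1) := by nlinarith
      _ ≤ _ := by gcongr
  have hsum : ∑ p ∈ N.primesBelow, δ * (Real.log p / p) ≤ 1 + Real.log 4 / Real.log 2 := by
    rw [← Finset.mul_sum]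
    have h1 : ∑ p ∈ N.primesBelow, Real.log p / p ≤ Real.log N + Real.log 4 := by
      refine (Finset.sum_le_sum_of_subset_of_nonneg ?_ ?_).trans
        (sum_log_div_primesBelow_le (n := N) (by omega))
      · intro p hp
        rw [Nat.mem_primesBelow] at hp ⊢
        exact ⟨by omega, hp.2⟩
      · intro p _ _
        have := Real.log_natCast_nonneg p
        positivity
    calc δ * ∑ p ∈ N.primesBelow, Real.log p / p ≤ δ * (Real.log N + Real.log 4) := by gcongr
      _ = 1 + Real.log 4 / Real.log N := by rw [hδdef]; field_simp
      _ ≤ _ := by gcongr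
  calc ∏ p ∈ N.primesBelow, (1 - (p : ℝ)⁻¹)⁻¹
      ≤ ∏ p ∈ N.primesBelow, Real.exp (2 * (δ * (Real.log p / p))) *
          (1 - (p : ℝ) ^ (-(1 + δ)))⁻¹ := by
        refine Finset.prod_le_prod (fun p hp => ?_) hcomp
        have hp2 : (1 : ℝ) ≤ p := by exact_mod_cast (Nat.prime_of_mem_primesBelow hp).one_le
        exact inv_nonneg.2 (sub_nonneg.2 (inv_le_one_of_one_le₀ hp2))
    _ = Real.exp (2 * ∑ p ∈ N.primesBelow, δ * (Real.log p / p)) *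
          ∏ p ∈ N.primesBelow, (1 - (p : ℝ) ^ (-(1 + δ)))⁻¹ := by
        rw [Finset.prod_mul_distrib, ← Real.exp_sum, Finset.mul_sum]
    _ ≤ Real.exp (2 * (1 + Real.log 4 / Real.log 2)) * (1 + 1 / δ) := by
        refine mul_le_mul (Real.exp_le_exp.2 (by linarith)) (prod_primesBelow_rpow_le hδ N) ?_
          (Real.exp_pos _).le
        refine Finset.prod_nonneg fun p hp => inv_nonneg.2 (sub_nonneg.2 ?_)
        have hp1 : (1 : ℝ) ≤ p := by exact_mod_cast (Nat.prime_of_mem_primesBelow hp).one_le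
        exact Real.rpow_le_one_of_one_le_of_nonpos hp1 (by linarith)
    _ = Real.exp (2 * (1 + Real.log 4 / Real.log 2)) * (1 + Real.log N) := by
        rw [hδdef, one_div_one_div]
    _ ≤ Real.exp (2 * (1 + Real.log 4 / Real.log 2)) *
          ((1 + 1 / Real.log 2) * Real.log N) := by
        gcongr
        have : 1 ≤ Real.log N / Real.log 2 := (one_le_div hlog2).2 hlogN
        have e : (1 + 1 / Real.log 2) * Real.log N = Real.log N + Real.log N / Real.log 2 := by
          ring
        linarith
    _ = _ := by ring

theorem exists_sum_inv_smooth_le :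
    ∃ C : ℝ, 0 < C ∧ ∀ N : ℕ, 2 ≤ N → ∀ s : Finset ℕ, (∀ n ∈ s, n ∈ N.smoothNumbers) →
      ∑ n ∈ s, (n : ℝ)⁻¹ ≤ C * Real.log N := by
  obtain ⟨C, hC, h⟩ := exists_prod_primesBelow_le
  refine ⟨C, hC, fun N hN s hs => le_trans ?_ (h N hN)⟩
  have hsum := (EulerProduct.summable_and_hasSum_smoothNumbers_prod_primesBelow_geometric
    (f := natRpowNegHom 1) (fun hp => natRpowNegHom_prime_lt_one one_pos hp) N).2
  have hle := sum_le_hasSum (s.subtype (· ∈ N.smoothNumbers)) (fun m _ => by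
    rw [natRpowNegHom_apply]; positivity) hsum
  rw [Finset.sum_subtype_of_mem (natRpowNegHom 1 ·) hs] at hle
  simpa [natRpowNegHom_apply, Real.rpow_neg_one] using hle

theorem sum_le_sum_of_injOn {α β : Type*} {s : Finset α} {t : Finset β}
    {f : α → ℝ} {g : β → ℝ} (e : α → β) (he : ∀ a ∈ s, e a ∈ t) (hinj : Set.InjOn e s)
    (hfg : ∀ a ∈ s, f a ≤ g (e a)) (hg : ∀ b ∈ t, 0 ≤ g b) :
    ∑ a ∈ s, f a ≤ ∑ b ∈ t, g b := by
  classical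
  calc ∑ a ∈ s, f a ≤ ∑ a ∈ s, g (e a) := Finset.sum_le_sum hfg
    _ = ∑ b ∈ s.image e, g b := (Finset.sum_image hinj).symm
    _ ≤ _ := Finset.sum_le_sum_of_subset_of_nonneg (Finset.image_subset_iff.2 he)
      fun b hb _ => hg b hb

/-- The integers in `[1, x]` without prime factors below `k`. -/
def roughUpTo (k x : ℕ) : Finset ℕ :=
  (Finset.Icc 1 x).filter fun n => ∀ p ∈ n.primeFactors, k ≤ p

theorem mem_roughUpTo {k x n : ℕ} :
    n ∈ roughUpTo k x ↔ (1 ≤ n ∧ n ≤ x) ∧ ∀ p, p.Prime → p ∣ n → k ≤ p := by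
  rw [roughUpTo, Finset.mem_filter, Finset.mem_Icc]
  refine and_congr_right fun h => ?_
  have : n ≠ 0 := by omega
  simp [Nat.mem_primeFactors, this]

theorem one_mem_roughUpTo {k x : ℕ} (hx : 1 ≤ x) : 1 ∈ roughUpTo k x :=
  mem_roughUpTo.2 ⟨⟨le_rfl, hx⟩, fun _ hp h => absurd (Nat.dvd_one.1 h) hp.ne_one⟩

theorem dvd_mem_roughUpTo {k x y m n : ℕ} (hn : n ∈ roughUpTo k x) (hmn : m ∣ n) (hm : m ≤ y) :
    m ∈ roughUpTo k y := by
  rw [mem_roughUpTo] at hn ⊢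
  exact ⟨⟨Nat.pos_of_dvd_of_pos hmn hn.1.1, hm⟩, fun p hp hpm => hn.2 p hp (hpm.trans hmn)⟩

theorem le_of_mem_roughUpTo {k x n : ℕ} (hn : n ∈ roughUpTo k x) (h1 : n ≠ 1) : k ≤ n := by
  rw [mem_roughUpTo] at hn
  exact (hn.2 _ (Nat.minFac_prime h1) (Nat.minFac_dvd n)).trans (Nat.minFac_le hn.1.1)

theorem coprime_of_mem_roughUpTo {k x m j : ℕ} (hm : m ∈ roughUpTo k x)
    (hj : j ∈ k.smoothNumbers) : m.Coprime j := by
  rw [mem_roughUpTo] at hm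
  rw [Nat.mem_smoothNumbers'] at hj
  refine Nat.coprime_of_dvd fun p hp hpm hpj => ?_
  have h1 := hm.2 p hp hpm
  have h2 := hj p hp hpj
  omega

theorem exists_rough_mul_smooth (k : ℕ) {n : ℕ} (hn : n ≠ 0) :
    ∃ m j : ℕ, n = m * j ∧ j ∈ k.smoothNumbers ∧ ∀ p, p.Prime → p ∣ m → k ≤ p := by
  induction n using induction_on_primes with
  | zero => exact absurd rfl hn
  | one => exact ⟨1, 1, rfl, by simp [Nat.mem_smoothNumbers],
      fun p hp h => absurd (Nat.dvd_one.1 h) hp.ne_one⟩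
  | prime_mul p a hp ih =>
    obtain ⟨m, j, rfl, hj, hm⟩ := ih (right_ne_zero_of_mul hn)
    rcases Nat.lt_or_ge p k with h | h
    · refine ⟨m, p * j, by ring, Nat.mul_mem_smoothNumbers ?_ hj, hm⟩
      exact Nat.mem_smoothNumbers_of_lt hp.pos h
    · refine ⟨p * m, j, by ring, hj, fun r hr hd => ?_⟩
      rcases (hr.dvd_mul).1 hd with h' | h'
      · rwa [(Nat.prime_dvd_prime_iff_eq hr hp).1 h']
      · exact hm r hr h'

theorem exists_sum_inv_rough_le :
    ∃ C : ℝ, 0 < C ∧ ∀ k x : ℕ, 2 ≤ k → k ≤ x →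
      (∑ m ∈ roughUpTo k x, (m : ℝ)⁻¹) * Real.log k ≤ C * Real.log x := by
  obtain ⟨C, hC, h⟩ := exists_sum_inv_smooth_le
  refine ⟨C * 2, by positivity, fun k x hk hkx => ?_⟩
  have hlogk : Real.log k ≤ ∑ j ∈ Finset.Icc 1 (k - 1), (j : ℝ)⁻¹ := by
    have := log_add_one_le_harmonic (k - 1)
    rw [harmonic_eq_sum_Icc, Nat.sub_add_cancel (by omega)] at this
    simpa using this
  have hsm : ∀ j ∈ Finset.Icc 1 (k - 1), j ∈ k.smoothNumbers := fun j hj => by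
    rw [Finset.mem_Icc] at hj
    exact Nat.mem_smoothNumbers_of_lt (by omega) (by omega)
  have hinj : Set.InjOn (fun y : ℕ × ℕ => y.1 * y.2)
      (roughUpTo k x ×ˢ Finset.Icc 1 (k - 1) : Finset (ℕ × ℕ)) := by
    rintro ⟨a, b⟩ hab ⟨c, d⟩ hcd heq
    rw [Finset.mem_coe, Finset.mem_product] at hab hcd
    obtain ⟨ha, hb⟩ := hab
    obtain ⟨hc, hd⟩ := hcd
    simp only at ha hb hc hd heq
    have h1 : a ∣ c := (coprime_of_mem_roughUpTo ha (hsm d hd)).dvd_of_dvd_mul_right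
      (heq ▸ Dvd.intro _ rfl)
    have h2 : c ∣ a := (coprime_of_mem_roughUpTo hc (hsm b hb)).dvd_of_dvd_mul_right
      (heq.symm ▸ Dvd.intro _ rfl)
    obtain rfl := Nat.dvd_antisymm h1 h2
    have ha0 : 0 < a := (mem_roughUpTo.1 ha).1.1
    rw [Nat.eq_of_mul_eq_mul_left ha0 heq]
  calc (∑ m ∈ roughUpTo k x, (m : ℝ)⁻¹) * Real.log k
      ≤ (∑ m ∈ roughUpTo k x, (m : ℝ)⁻¹) * ∑ j ∈ Finset.Icc 1 (k - 1), (j : ℝ)⁻¹ := by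
        gcongr
    _ = ∑ y ∈ roughUpTo k x ×ˢ Finset.Icc 1 (k - 1), ((y.1 * y.2 : ℕ) : ℝ)⁻¹ := by
        rw [Finset.sum_mul_sum, ← Finset.sum_product']
        refine Finset.sum_congr rfl fun y _ => ?_
        rw [Nat.cast_mul, mul_inv]
    _ = ∑ n ∈ (roughUpTo k x ×ˢ Finset.Icc 1 (k - 1)).image (fun y : ℕ × ℕ => y.1 * y.2),
          (n : ℝ)⁻¹ := by
        rw [Finset.sum_image hinj]
    _ ≤ C * Real.log (x + 1 : ℕ) := by
        refine h (x + 1) (by omega) _ fun n hn => ?_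
        obtain ⟨⟨a, b⟩, hab, rfl⟩ := Finset.mem_image.1 hn
        obtain ⟨ha, hb⟩ := Finset.mem_product.1 hab
        have ha' := (mem_roughUpTo.1 ha).1
        refine Nat.mul_mem_smoothNumbers ?_ ?_
        · exact Nat.mem_smoothNumbers_of_lt ha'.1 (by simp only at ha' ⊢; omega)
        · exact Nat.smoothNumbers_mono (by omega) (hsm b hb)
    _ ≤ C * (2 * Real.log x) := by
        gcongr
        rw [← Nat.cast_two, ← Real.log_pow]
        refine Real.log_le_log (by positivity) ?_
        have : x + 1 ≤ x ^ 2 := by nlinarith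
        exact_mod_cast this
    _ = _ := by ring

theorem exists_log_le_sum_inv_rough :
    ∃ C : ℝ, 0 < C ∧ ∀ (k : ℕ) (y : ℝ), 2 ≤ k → 0 ≤ y →
      Real.log y ≤ C * Real.log k * ∑ m ∈ roughUpTo k ⌊y⌋₊, (m : ℝ)⁻¹ := by
  obtain ⟨C, hC, h⟩ := exists_sum_inv_smooth_le
  refine ⟨C, hC, fun k y hk hy => ?_⟩
  classical
  have hdec : ∀ n : ℕ, ∃ w : ℕ × ℕ, n ≠ 0 → n = w.1 * w.2 ∧ w.2 ∈ k.smoothNumbers ∧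
      ∀ p, p.Prime → p ∣ w.1 → k ≤ p := by
    intro n
    by_cases hn : n = 0
    · exact ⟨(0, 0), fun h => absurd hn h⟩
    · obtain ⟨m, j, h⟩ := exists_rough_mul_smooth k hn
      exact ⟨(m, j), fun _ => h⟩
  choose w hw using hdec
  set S := (Finset.Icc 1 ⌊y⌋₊).filter (· ∈ k.smoothNumbers)
  have hne : ∀ n ∈ Finset.Icc 1 ⌊y⌋₊, n ≠ 0 := fun n hn => by
    rw [Finset.mem_Icc] at hn; omega
  calc Real.log y ≤ ∑ n ∈ Finset.Icc 1 ⌊y⌋₊, (n : ℝ)⁻¹ := by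
        have := log_le_harmonic_floor y hy
        rw [harmonic_eq_sum_Icc] at this
        simpa using this
    _ ≤ ∑ v ∈ roughUpTo k ⌊y⌋₊ ×ˢ S, (v.1 : ℝ)⁻¹ * (v.2 : ℝ)⁻¹ := by
        refine sum_le_sum_of_injOn w (fun n hn => ?_) (fun a ha b hb hab => ?_)
          (fun n hn => ?_) (fun _ _ => by positivity)
        · obtain ⟨h1, h2, h3⟩ := hw n (hne n hn)
          rw [Finset.mem_Icc] at hn
          have h4 : 0 < (w n).1 * (w n).2 := by omega
          have h5 : 0 < (w n).1 := Nat.pos_of_mul_pos_right h4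
          have h6 : 0 < (w n).2 := Nat.pos_of_mul_pos_left h4
          rw [Finset.mem_product, mem_roughUpTo, Finset.mem_filter, Finset.mem_Icc]
          exact ⟨⟨⟨h5, by nlinarith⟩, h3⟩, ⟨h6, by nlinarith⟩, h2⟩
        · rw [(hw a (hne a ha)).1, (hw b (hne b hb)).1, hab]
        · conv_lhs => rw [(hw n (hne n hn)).1]
          rw [Nat.cast_mul, mul_inv]
    _ = (∑ m ∈ roughUpTo k ⌊y⌋₊, (m : ℝ)⁻¹) * ∑ j ∈ S, (j : ℝ)⁻¹ := by
        rw [Finset.sum_mul_sum, ← Finset.sum_product']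
    _ ≤ (∑ m ∈ roughUpTo k ⌊y⌋₊, (m : ℝ)⁻¹) * (C * Real.log k) := by
        gcongr
        exact h k hk S fun n hn => (Finset.mem_filter.1 hn).2
    _ = _ := by ring

/-- Upper bound for the number of rough integers, uniform in `k ≤ x`. -/
theorem exists_card_roughUpTo_le :
    ∃ C : ℝ, 0 < C ∧ ∀ k x : ℕ, 2 ≤ k → k ≤ x →
      ((roughUpTo k x).card : ℝ) * Real.log k ≤ C * x := by
  obtain ⟨C, hC, h⟩ := exists_sum_inv_rough_le
  refine ⟨(Real.log 4 + 5) * C, by positivity, fun k x hk hkx => ?_⟩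
  have hx0 : (0 : ℝ) < x := by exact_mod_cast (by omega : 0 < x)
  have hlogx : 0 < Real.log x := Real.log_pos (by exact_mod_cast (by omega : 1 < x))
  have hlogk : 0 < Real.log k := Real.log_pos (by exact_mod_cast (by omega : 1 < k))
  have hlogsum : ∑ n ∈ roughUpTo k x, Real.log n ≤
      ∑ m ∈ roughUpTo k x, Chebyshev.psi ((x : ℝ) / m) := by
    calc ∑ n ∈ roughUpTo k x, Real.log n
        = ∑ n ∈ roughUpTo k x, ∑ y ∈ n.divisorsAntidiagonal,
            ArithmeticFunction.vonMangoldt y.2 := by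
          refine Finset.sum_congr rfl fun n _ => ?_
          rw [Nat.sum_divisorsAntidiagonal' (f := fun _ d => ArithmeticFunction.vonMangoldt d),
            ArithmeticFunction.vonMangoldt_sum]
      _ = ∑ y ∈ (roughUpTo k x).sigma fun n => n.divisorsAntidiagonal,
            ArithmeticFunction.vonMangoldt y.2.2 := Finset.sum_sigma' _ _ _
      _ ≤ ∑ y ∈ (roughUpTo k x).sigma fun m => Finset.Ioc 0 ⌊(x : ℝ) / m⌋₊,
            ArithmeticFunction.vonMangoldt y.2 := by
          refine sum_le_sum_of_injOn (fun y => (⟨y.2.1, y.2.2⟩ : Σ _ : ℕ, ℕ)) ?_ ?_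
            (fun _ _ => le_rfl) (fun _ _ => ArithmeticFunction.vonMangoldt_nonneg)
          · rintro ⟨n, m, d⟩ hy
            rw [Finset.mem_sigma] at hy ⊢
            obtain ⟨hn, hmd⟩ := hy
            simp only [Nat.mem_divisorsAntidiagonal] at hn hmd ⊢
            obtain ⟨rfl, h0⟩ := hmd
            have hn' := (mem_roughUpTo.1 hn).1
            have hm0 : 0 < m := Nat.pos_of_mul_pos_right (Nat.pos_of_ne_zero h0)
            have hd0 : 0 < d := Nat.pos_of_mul_pos_left (Nat.pos_of_ne_zero h0)
            refine ⟨dvd_mem_roughUpTo hn (Dvd.intro _ rfl) (by nlinarith), ?_⟩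
            rw [Finset.mem_Ioc, Nat.floor_div_eq_div, Nat.le_div_iff_mul_le hm0]
            exact ⟨hd0, by linarith [mul_comm m d]⟩
          · rintro ⟨n, m, d⟩ hy ⟨n', m', d'⟩ hy' heq
            simp only [Finset.coe_sigma, Set.mem_sigma_iff, Finset.mem_coe,
              Nat.mem_divisorsAntidiagonal] at hy hy'
            simp only [Sigma.mk.injEq, heq_eq_eq] at heq
            obtain ⟨rfl, rfl⟩ := heq
            obtain rfl := hy.2.1
            obtain rfl := hy'.2.1
            rfl
      _ = _ := by rw [Finset.sum_sigma]; rfl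
  have hmain : ((roughUpTo k x).card : ℝ) * Real.log x ≤
      (Real.log 4 + 5) * x * ∑ m ∈ roughUpTo k x, (m : ℝ)⁻¹ := by
    calc ((roughUpTo k x).card : ℝ) * Real.log x = ∑ _n ∈ roughUpTo k x, Real.log x := by
          rw [Finset.sum_const, nsmul_eq_mul]
      _ ≤ ∑ n ∈ roughUpTo k x, (Real.log n + x * (n : ℝ)⁻¹) := by
          refine Finset.sum_le_sum fun n hn => ?_
          have hn0 : (0 : ℝ) < n := by exact_mod_cast (mem_roughUpTo.1 hn).1.1
          have := Real.log_le_sub_one_of_pos (div_pos hx0 hn0)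
          rw [Real.log_div hx0.ne' hn0.ne', div_eq_mul_inv] at this
          linarith
      _ = ∑ n ∈ roughUpTo k x, Real.log n + x * ∑ m ∈ roughUpTo k x, (m : ℝ)⁻¹ := by
          rw [Finset.sum_add_distrib, Finset.mul_sum]
      _ ≤ (Real.log 4 + 4) * x * ∑ m ∈ roughUpTo k x, (m : ℝ)⁻¹ +
            x * ∑ m ∈ roughUpTo k x, (m : ℝ)⁻¹ := by
          gcongr
          refine hlogsum.trans ?_
          rw [Finset.mul_sum]
          refine Finset.sum_le_sum fun m _ => ?_
          refine (Chebyshev.psi_le_const_mul_self (by positivity)).trans_eq ?_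
          ring
      _ = _ := by ring
  have h1 : ((roughUpTo k x).card : ℝ) * Real.log k * Real.log x ≤
      (Real.log 4 + 5) * C * x * Real.log x := by
    calc ((roughUpTo k x).card : ℝ) * Real.log k * Real.log x
        = ((roughUpTo k x).card : ℝ) * Real.log x * Real.log k := by ring
      _ ≤ (Real.log 4 + 5) * x * (∑ m ∈ roughUpTo k x, (m : ℝ)⁻¹) * Real.log k := by gcongr
      _ = (Real.log 4 + 5) * x * ((∑ m ∈ roughUpTo k x, (m : ℝ)⁻¹) * Real.log k) := by ring
      _ ≤ (Real.log 4 + 5) * x * (C * Real.log x) := by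
          exact mul_le_mul_of_nonneg_left (h k x hk hkx) (by positivity)
      _ = _ := by ring
  exact le_of_mul_le_mul_right h1 hlogx

theorem exists_half_le_theta :
    ∃ X : ℝ, 1 ≤ X ∧ ∀ x : ℝ, X ≤ x → x / 2 ≤ Chebyshev.theta x := by
  obtain ⟨C, hC⟩ := Chebyshev.psi_sub_theta_le_mul_sqrt
  refine ⟨(10 * (5 + |C|)) ^ 2, ?_, fun x hx => ?_⟩
  · have := abs_nonneg C
    nlinarith
  have hC0 := abs_nonneg C
  have hx2 : 2 ≤ x := by nlinarith
  have hsq : 10 * (5 + |C|) ≤ √x := Real.le_sqrt_of_sq_le hx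
  have hxs : √x * √x = x := Real.mul_self_sqrt (by linarith)
  have h1 := Chebyshev.psi_ge' (x := x) (by linarith)
  have h2 := hC x
  have h3 : C * √x ≤ |C| * √x := by gcongr; exact le_abs_self C
  have h4 : Real.log (x + 2) ≤ 4 * √x := by
    have e : Real.log (x + 2) = 2 * Real.log √(x + 2) := by
      rw [Real.log_sqrt (by linarith)]; ring
    have h5 := Real.log_le_sub_one_of_pos (Real.sqrt_pos.2 (by linarith : 0 < x + 2))
    have h6 : √(x + 2) ≤ 2 * √x := by
      rw [Real.sqrt_le_left (by positivity)]
      nlinarith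
    linarith
  have h7 := Real.log_two_gt_d9
  have h8 := Real.log_two_lt_d9
  nlinarith

theorem theta_le_add_sum (a b : ℕ) :
    Chebyshev.theta b ≤ Chebyshev.theta a +
      ∑ p ∈ (Finset.Ioc a b).filter Nat.Prime, Real.log p := by
  classical
  rw [Chebyshev.theta, Chebyshev.theta, Nat.floor_natCast, Nat.floor_natCast,
    ← Finset.sum_union]
  · refine Finset.sum_le_sum_of_subset_of_nonneg (fun p hp => ?_)
      fun p _ _ => Real.log_natCast_nonneg p
    simp only [Finset.mem_union, Finset.mem_filter, Finset.mem_Ioc] at hp ⊢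
    obtain ⟨⟨h1, h2⟩, h3⟩ := hp
    rcases Nat.lt_or_ge a p with h | h
    · exact Or.inr ⟨⟨h, h2⟩, h3⟩
    · exact Or.inl ⟨⟨h1, h⟩, h3⟩
  · rw [Finset.disjoint_left]
    intro p hp hp'
    simp only [Finset.mem_filter, Finset.mem_Ioc] at hp hp'
    omega

theorem card_roughUpTo_mul_log_ge {X : ℝ} (hX : ∀ x : ℝ, X ≤ x → x / 2 ≤ Chebyshev.theta x)
    {k U : ℕ} {w : ℝ} (hw : w ^ 4 = U) (hw6 : 6 ≤ w) (hwX : X ≤ w ^ 3) (hk : (k : ℝ) ≤ w + 1) :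
    (U : ℝ) / 4 * ∑ m ∈ roughUpTo k ⌊w⌋₊, (m : ℝ)⁻¹ ≤ (roughUpTo k U).card * Real.log U := by
  have hw0 : 0 ≤ w := by linarith
  have hww : w + 1 ≤ w ^ 2 - 1 := by nlinarith
  have hfl : w ^ 2 < (⌊w ^ 2⌋₊ : ℝ) + 1 := Nat.lt_floor_add_one _
  have hkp : ∀ p : ℕ, ⌊w ^ 2⌋₊ < p → w + 1 ≤ p := fun p hp => by
    have : ((⌊w ^ 2⌋₊ : ℕ) : ℝ) + 1 ≤ p := by exact_mod_cast hp
    linarith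
  have hmw : ∀ m ∈ roughUpTo k ⌊w⌋₊, (m : ℝ) ≤ w ∧ (1 : ℝ) ≤ m := fun m hm => by
    have := (mem_roughUpTo.1 hm).1
    exact ⟨(Nat.le_floor_iff hw0).1 this.2, by exact_mod_cast this.1⟩
  calc (U : ℝ) / 4 * ∑ m ∈ roughUpTo k ⌊w⌋₊, (m : ℝ)⁻¹
      ≤ ∑ m ∈ roughUpTo k ⌊w⌋₊,
          ∑ p ∈ (Finset.Ioc ⌊w ^ 2⌋₊ (U / m)).filter Nat.Prime, Real.log p := by
        rw [Finset.mul_sum]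
        refine Finset.sum_le_sum fun m hm => ?_
        obtain ⟨h1, h2⟩ := hmw m hm
        have hm0 : (0 : ℝ) < m := by linarith
        have h3 := theta_le_add_sum ⌊w ^ 2⌋₊ (U / m)
        rw [← Chebyshev.theta_eq_theta_coe_floor, ← Nat.floor_div_eq_div (K := ℝ),
          ← Chebyshev.theta_eq_theta_coe_floor] at h3
        have h4 : w ^ 3 ≤ (U : ℝ) / m := by
          rw [le_div_iff₀ hm0, ← hw, show w ^ 4 = w ^ 3 * w by ring]
          gcongr
        have h5 := hX _ (hwX.trans h4)
        have h6 := Chebyshev.theta_le_log4_mul_x (x := w ^ 2) (by positivity)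
        have h7 : Real.log 4 ≤ 3 / 2 := by
          rw [show (4 : ℝ) = 2 ^ 2 by norm_num, Real.log_pow]
          have := Real.log_two_lt_d9
          push_cast
          linarith
        have h8 : Real.log 4 * w ^ 2 ≤ w ^ 3 / 4 := by
          have : Real.log 4 * w ^ 2 ≤ 3 / 2 * w ^ 2 := by gcongr
          nlinarith [sq_nonneg w]
        rw [Nat.floor_div_eq_div] at h3
        have e : (U : ℝ) / 4 * (m : ℝ)⁻¹ = (U : ℝ) / m / 4 := by ring
        rw [e]
        linarith
    _ = ∑ y ∈ (roughUpTo k ⌊w⌋₊).sigma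
          fun m => (Finset.Ioc ⌊w ^ 2⌋₊ (U / m)).filter Nat.Prime, Real.log y.2 :=
        Finset.sum_sigma' _ _ _
    _ ≤ ∑ _n ∈ roughUpTo k U, Real.log U := by
        refine sum_le_sum_of_injOn (fun y => y.1 * y.2) ?_ ?_ ?_
          (fun _ _ => Real.log_natCast_nonneg U)
        · rintro ⟨m, p⟩ hy
          simp only [Finset.mem_sigma, Finset.mem_filter, Finset.mem_Ioc] at hy ⊢
          obtain ⟨hm, ⟨hp1, hp2⟩, hp⟩ := hy
          have hm' := mem_roughUpTo.1 hm
          refine mem_roughUpTo.2 ⟨⟨Nat.mul_pos hm'.1.1 hp.pos, ?_⟩, fun r hr hd => ?_⟩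
          · rw [Nat.le_div_iff_mul_le hm'.1.1] at hp2
            linarith [mul_comm m p]
          · rcases (hr.dvd_mul).1 hd with h | h
            · exact hm'.2 r hr h
            · rw [(Nat.prime_dvd_prime_iff_eq hr hp).1 h]
              exact_mod_cast hk.trans (hkp p hp1)
        · rintro ⟨m, p⟩ hy ⟨m', p'⟩ hy' heq
          simp only [Finset.coe_sigma, Set.mem_sigma_iff, Finset.mem_coe, Finset.mem_filter,
            Finset.mem_Ioc] at hy hy' heq
          obtain ⟨hm, ⟨hp1, -⟩, hp⟩ := hy
          obtain ⟨hm', ⟨-, -⟩, hp'⟩ := hy'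
          have hpp : p = p' := by
            rcases (hp.dvd_mul).1 (heq ▸ Dvd.intro_left m rfl : p ∣ m' * p') with h | h
            · have h1 : p ≤ m' := Nat.le_of_dvd (mem_roughUpTo.1 hm').1.1 h
              have h2 : (p : ℝ) ≤ m' := by exact_mod_cast h1
              have h3 := (hmw m' hm').1
              have h4 := hkp p hp1
              linarith
            · exact (Nat.prime_dvd_prime_iff_eq hp hp').1 h
          subst hpp
          rw [Nat.eq_of_mul_eq_mul_right hp.pos heq]
        · rintro ⟨m, p⟩ hy
          simp only [Finset.mem_sigma, Finset.mem_filter, Finset.mem_Ioc] at hy ⊢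
          refine Real.log_le_log (by exact_mod_cast hy.2.2.pos) ?_
          exact_mod_cast hy.2.1.2.trans (Nat.div_le_self _ _)
    _ = _ := by rw [Finset.sum_const, nsmul_eq_mul]

/-- Lower bound for the number of rough integers in `[1, U]` for `k` up to about `U ^ (1 / 4)`. -/
theorem exists_le_card_roughUpTo :
    ∃ C : ℝ, 0 < C ∧ ∀ k U : ℕ, 2 ≤ k → 1 ≤ U → (k : ℝ) ≤ (U : ℝ) ^ (1 / 4 : ℝ) + 1 →
      (U : ℝ) ≤ C * ((roughUpTo k U).card * Real.log k) := by
  obtain ⟨X, hX1, hX⟩ := exists_half_le_theta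
  obtain ⟨C, hC, h⟩ := exists_log_le_sum_inv_rough
  have hlog2 : 0 < Real.log 2 := Real.log_pos one_lt_two
  refine ⟨16 * C + (X + 6) ^ 4 / Real.log 2, by positivity, fun k U hk hU hkU => ?_⟩
  have hlogk : Real.log 2 ≤ Real.log k := Real.log_le_log two_pos (by exact_mod_cast hk)
  have hlogk0 : 0 < Real.log k := hlog2.trans_le hlogk
  have hU0 : (0 : ℝ) < U := by exact_mod_cast hU
  set w : ℝ := (U : ℝ) ^ (1 / 4 : ℝ) with hwdef
  have hw0 : 0 < w := by positivity
  have hw : w ^ 4 = U := by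
    rw [hwdef, ← Real.rpow_natCast, ← Real.rpow_mul hU0.le]
    norm_num
  rw [add_mul]
  rcases le_or_gt (X + 6) w with hwX | hwX
  · have hw6 : 6 ≤ w := by linarith
    have h1 := card_roughUpTo_mul_log_ge hX hw hw6 (by nlinarith [sq_nonneg w]) hkU
    have h2 := h k w hk hw0.le
    have hlogw : Real.log U = 4 * Real.log w := by
      rw [← hw, Real.log_pow]; norm_num
    have hlogw0 : 0 < Real.log w := Real.log_pos (by linarith)
    have h3 : (U : ℝ) * Real.log w ≤
        16 * C * ((roughUpTo k U).card * Real.log k) * Real.log w := by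
      calc (U : ℝ) * Real.log w
          ≤ U * (C * Real.log k * ∑ m ∈ roughUpTo k ⌊w⌋₊, (m : ℝ)⁻¹) := by gcongr
        _ = 4 * C * Real.log k * ((U : ℝ) / 4 * ∑ m ∈ roughUpTo k ⌊w⌋₊, (m : ℝ)⁻¹) := by ring
        _ ≤ 4 * C * Real.log k * ((roughUpTo k U).card * Real.log U) := by gcongr
        _ = _ := by rw [hlogw]; ring
    have h4 := le_of_mul_le_mul_right h3 hlogw0
    have h5 : 0 ≤ (X + 6) ^ 4 / Real.log 2 * ((roughUpTo k U).card * Real.log k) := by positivity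
    linarith
  · have hcard : (1 : ℝ) ≤ (roughUpTo k U).card := by
      exact_mod_cast Finset.card_pos.2 ⟨1, one_mem_roughUpTo hU⟩
    have h1 : (U : ℝ) ≤ (X + 6) ^ 4 := by
      rw [← hw]; gcongr
    have h2 : (X + 6) ^ 4 ≤
        (X + 6) ^ 4 / Real.log 2 * ((roughUpTo k U).card * Real.log k) := by
      calc (X + 6) ^ 4 = (X + 6) ^ 4 / Real.log 2 * (1 * Real.log 2) := by field_simp
        _ ≤ _ := by gcongr
    have h5 : 0 ≤ 16 * C * ((roughUpTo k U).card * Real.log k) := by positivity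
    linarith

theorem sum_gcd_div_le_sum_card (k U : ℕ) :
    ∑ y ∈ (roughUpTo k U ×ˢ roughUpTo k U).filter (fun y => y.1 < y.2),
        (Nat.gcd y.1 y.2 : ℝ) / y.2 ≤
      ∑ g ∈ roughUpTo k U, ∑ v ∈ (roughUpTo k (U / g)).erase 1,
        ((roughUpTo k v).card : ℝ) * (v : ℝ)⁻¹ := by
  calc ∑ y ∈ (roughUpTo k U ×ˢ roughUpTo k U).filter (fun y => y.1 < y.2),
        (Nat.gcd y.1 y.2 : ℝ) / y.2
      ≤ ∑ y ∈ (roughUpTo k U).sigma fun g =>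
          ((roughUpTo k (U / g)).erase 1).sigma fun v => roughUpTo k v, (y.2.1 : ℝ)⁻¹ := by
        refine sum_le_sum_of_injOn (fun y => (⟨Nat.gcd y.1 y.2, y.2 / Nat.gcd y.1 y.2,
          y.1 / Nat.gcd y.1 y.2⟩ : Σ _ : ℕ, Σ _ : ℕ, ℕ)) ?_ ?_ ?_ (fun _ _ => by positivity)
        · rintro ⟨a, b⟩ hy
          simp only [Finset.mem_filter, Finset.mem_product] at hy
          obtain ⟨⟨ha, hb⟩, hab⟩ := hy
          have ha' := (mem_roughUpTo.1 ha).1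
          have hb' := (mem_roughUpTo.1 hb).1
          have hg : 0 < Nat.gcd a b := Nat.gcd_pos_of_pos_left _ ha'.1
          have hlt : a / Nat.gcd a b < b / Nat.gcd a b :=
            Nat.div_lt_div_of_lt_of_dvd (Nat.gcd_dvd_right a b) hab
          have hpos : 0 < a / Nat.gcd a b :=
            Nat.div_pos (Nat.gcd_le_left _ ha'.1) hg
          simp only [Finset.mem_sigma, Finset.mem_erase]
          exact ⟨dvd_mem_roughUpTo ha (Nat.gcd_dvd_left a b)
              ((Nat.gcd_le_left _ ha'.1).trans ha'.2),
            ⟨by omega, dvd_mem_roughUpTo hb (Nat.div_dvd_of_dvd (Nat.gcd_dvd_right a b))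
              (Nat.div_le_div_right hb'.2)⟩,
            dvd_mem_roughUpTo ha (Nat.div_dvd_of_dvd (Nat.gcd_dvd_left a b)) hlt.le⟩
        · rintro ⟨a, b⟩ _ ⟨c, d⟩ _ heq
          simp only [Sigma.mk.injEq, heq_eq_eq] at heq
          obtain ⟨h1, h2, h3⟩ := heq
          have hac : a = c := by
            rw [← Nat.div_mul_cancel (Nat.gcd_dvd_left a b), h3, h1,
              Nat.div_mul_cancel (Nat.gcd_dvd_left c d)]
          have hbd : b = d := by
            rw [← Nat.div_mul_cancel (Nat.gcd_dvd_right a b), h2, h1,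
              Nat.div_mul_cancel (Nat.gcd_dvd_right c d)]
          rw [hac, hbd]
        · rintro ⟨a, b⟩ hy
          simp only [Finset.mem_filter, Finset.mem_product] at hy
          have ha' := (mem_roughUpTo.1 hy.1.1).1
          have hg : ((Nat.gcd a b : ℕ) : ℝ) ≠ 0 := by
            exact_mod_cast (Nat.gcd_pos_of_pos_left b ha'.1).ne'
          simp only
          rw [Nat.cast_div (Nat.gcd_dvd_right a b) hg, inv_div]
    _ = _ := by
        rw [Finset.sum_sigma]
        refine Finset.sum_congr rfl fun g _ => ?_
        rw [Finset.sum_sigma]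
        refine Finset.sum_congr rfl fun v _ => ?_
        change ∑ _s ∈ roughUpTo k v, (v : ℝ)⁻¹ = _
        rw [Finset.sum_const, nsmul_eq_mul]

theorem exists_sum_gcd_div_le :
    ∃ C : ℝ, 0 < C ∧ ∀ k U : ℕ, 2 ≤ k → k ≤ U → (k : ℝ) ≤ (U : ℝ) ^ (1 / 4 : ℝ) + 1 →
      ∑ y ∈ (roughUpTo k U ×ˢ roughUpTo k U).filter (fun y => y.1 < y.2),
          (Nat.gcd y.1 y.2 : ℝ) / y.2 ≤
        C * ((roughUpTo k U).card * (Real.log U / Real.log k ^ 2)) := by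
  obtain ⟨C₁, hC₁, h₁⟩ := exists_card_roughUpTo_le
  obtain ⟨C₂, hC₂, h₂⟩ := exists_sum_inv_rough_le
  obtain ⟨C₃, hC₃, h₃⟩ := exists_le_card_roughUpTo
  refine ⟨C₁ ^ 2 * C₂ * C₃, by positivity, fun k U hk hkU hkU4 => ?_⟩
  have hlogk : 0 < Real.log k := Real.log_pos (by exact_mod_cast (by omega : 1 < k))
  have hlogU : 0 < Real.log U := Real.log_pos (by exact_mod_cast (by omega : 1 < U))
  set L := Real.log k
  have hinner : ∀ g ∈ roughUpTo k U, ∑ v ∈ (roughUpTo k (U / g)).erase 1,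
      ((roughUpTo k v).card : ℝ) * (v : ℝ)⁻¹ ≤ C₁ ^ 2 * U / L ^ 2 * (g : ℝ)⁻¹ := by
    intro g hg
    have hg0 : (0 : ℝ) < g := by exact_mod_cast (mem_roughUpTo.1 hg).1.1
    have hterm : ∀ v ∈ (roughUpTo k (U / g)).erase 1,
        ((roughUpTo k v).card : ℝ) * (v : ℝ)⁻¹ ≤ C₁ / L := by
      intro v hv
      rw [Finset.mem_erase] at hv
      have hv0 : (0 : ℝ) < v := by exact_mod_cast (mem_roughUpTo.1 hv.2).1.1
      rw [← div_eq_mul_inv, div_le_div_iff₀ hv0 hlogk]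
      exact h₁ k v hk (le_of_mem_roughUpTo hv.2 hv.1)
    have hcard : (((roughUpTo k (U / g)).erase 1).card : ℝ) ≤ C₁ * (U / g) / L := by
      rcases Nat.lt_or_ge (U / g) k with hlt | hge
      · have : (roughUpTo k (U / g)).erase 1 = ∅ := by
          rw [Finset.eq_empty_iff_forall_notMem]
          intro v hv
          rw [Finset.mem_erase] at hv
          have h1 := le_of_mem_roughUpTo hv.2 hv.1
          have h2 := (mem_roughUpTo.1 hv.2).1.2
          omega
        rw [this]
        simp only [Finset.card_empty, Nat.cast_zero]
        positivity
      · rw [le_div_iff₀ hlogk]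
        calc (((roughUpTo k (U / g)).erase 1).card : ℝ) * L
            ≤ (roughUpTo k (U / g)).card * L := by
              gcongr
              exact Finset.erase_subset _ _
          _ ≤ C₁ * ((U / g : ℕ) : ℝ) := h₁ k _ hk hge
          _ ≤ C₁ * (U / g) := by
              gcongr
              exact Nat.cast_div_le
    calc ∑ v ∈ (roughUpTo k (U / g)).erase 1, ((roughUpTo k v).card : ℝ) * (v : ℝ)⁻¹
        ≤ ((roughUpTo k (U / g)).erase 1).card * (C₁ / L) := by
          rw [← nsmul_eq_mul]
          exact Finset.sum_le_card_nsmul _ _ _ hterm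
      _ ≤ C₁ * (U / g) / L * (C₁ / L) := by gcongr
      _ = _ := by field_simp
  calc _ ≤ ∑ g ∈ roughUpTo k U, C₁ ^ 2 * U / L ^ 2 * (g : ℝ)⁻¹ :=
        (sum_gcd_div_le_sum_card k U).trans (Finset.sum_le_sum hinner)
    _ = C₁ ^ 2 * U / L ^ 3 * ((∑ g ∈ roughUpTo k U, (g : ℝ)⁻¹) * L) := by
        rw [← Finset.mul_sum]; field_simp
    _ ≤ C₁ ^ 2 * U / L ^ 3 * (C₂ * Real.log U) :=
        mul_le_mul_of_nonneg_left (h₂ k U hk hkU) (by positivity)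
    _ ≤ C₁ ^ 2 * (C₃ * ((roughUpTo k U).card * L)) / L ^ 3 * (C₂ * Real.log U) := by
        gcongr
        exact h₃ k U hk (by omega) hkU4
    _ = _ := by field_simp

theorem Int.eq_of_ediv_eq_of_dvd_sub {q a b : ℤ} (h : a / q = b / q) (hd : q ∣ a - b) : a = b := by
  have hm : a % q = b % q := (Int.modEq_iff_dvd.2 hd).symm
  rw [← Int.mul_ediv_add_emod a q, ← Int.mul_ediv_add_emod b q, h, hm]

theorem card_filter_dvd_linear_le {q M N v₁ v₂ : ℤ} (hq : 0 < q) (hN : 0 < N) (h₁ : 0 < v₁)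
    (h₁₂ : v₁ ≤ v₂) (hc : IsCoprime v₁ v₂) (hqN : v₂ * N ≤ q) :
    (((Finset.Ioc M (M + N) ×ˢ Finset.Ioc M (M + N)).filter
      fun x => q ∣ v₁ * x.1 - v₂ * x.2).card : ℝ) ≤ 2 * ((N : ℝ) / v₂ + 1) := by
  have h₂ : 0 < v₂ := h₁.trans_le h₁₂
  have hcard : ((Finset.Ioc M (M + N) ×ˢ Finset.Ioc M (M + N)).filter
      fun x => q ∣ v₁ * x.1 - v₂ * x.2).card ≤
        (Finset.Ico (0 : ℤ) 2 ×ˢ Finset.Ico 0 (N / v₂ + 1)).card := by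
    refine Finset.card_le_card_of_injOn (fun x =>
      ((v₁ * x.1 - v₂ * x.2 - (v₁ * (M + 1) - v₂ * (M + N))) / q, (x.1 - M - 1) / v₂)) ?_ ?_
    · rintro ⟨a, b⟩ hx
      simp only [Finset.coe_filter, Finset.mem_product, Finset.mem_Ioc, Set.mem_ofPred_eq] at hx
      obtain ⟨⟨⟨ha1, ha2⟩, hb1, hb2⟩, -⟩ := hx
      simp only [Finset.coe_product, Finset.coe_Ico, Set.mem_prod, Set.mem_Ico]
      have e : v₁ * a - v₂ * b - (v₁ * (M + 1) - v₂ * (M + N)) =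
        v₁ * (a - M - 1) + v₂ * (M + N - b) := by ring
      rw [e]
      have i1 : 0 ≤ v₁ * (a - M - 1) := mul_nonneg h₁.le (by omega)
      have i2 : 0 ≤ v₂ * (M + N - b) := mul_nonneg h₂.le (by omega)
      have i3 : v₁ * (a - M - 1) ≤ v₂ * (N - 1) :=
        mul_le_mul h₁₂ (by omega) (by omega) h₂.le
      have i4 : v₂ * (M + N - b) ≤ v₂ * (N - 1) :=
        mul_le_mul_of_nonneg_left (by omega) h₂.le
      have i5 : v₂ * (N - 1) < q := by rw [mul_sub, mul_one]; omega
      refine ⟨⟨Int.ediv_nonneg (by omega) hq.le, ?_⟩, Int.ediv_nonneg (by omega) h₂.le, ?_⟩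
      · exact Int.ediv_lt_of_lt_mul hq (by omega)
      · exact Int.lt_add_one_of_le (Int.ediv_le_ediv h₂ (by omega))
    · rintro ⟨a, b⟩ hx ⟨c, d⟩ hy heq
      simp only [Finset.coe_filter, Set.mem_ofPred_eq] at hx hy
      simp only [Prod.mk.injEq] at heq
      obtain ⟨e1, e2⟩ := heq
      have h3 := Int.eq_of_ediv_eq_of_dvd_sub e1 (by
        rw [sub_sub_sub_cancel_right]; exact dvd_sub hx.2 hy.2)
      have h4 : v₁ * (a - c) = v₂ * (b - d) := by linarith
      have h5 : v₂ ∣ a - c := hc.symm.dvd_of_dvd_mul_left (h4 ▸ Dvd.intro _ rfl)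
      have h6 := Int.eq_of_ediv_eq_of_dvd_sub e2 (by
        rwa [show a - M - 1 - (c - M - 1) = a - c by ring])
      have h7 : a = c := by omega
      rw [h7, sub_self, mul_zero] at h4
      have h8 : b = d := by
        rcases mul_eq_zero.1 h4.symm with h | h <;> omega
      rw [h7, h8]
  rw [Finset.card_product, Int.card_Ico, Int.card_Ico] at hcard
  have hnn : 0 ≤ N / v₂ := Int.ediv_nonneg hN.le h₂.le
  have h9 : (((N / v₂ + 1 - 0).toNat : ℕ) : ℝ) = ((N / v₂ : ℤ) : ℝ) + 1 := by
    rw [← Int.cast_natCast, Int.toNat_of_nonneg (by omega)]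
    push_cast
    ring
  calc _ ≤ (((2 - 0 : ℤ).toNat * (N / v₂ + 1 - 0).toNat : ℕ) : ℝ) := by exact_mod_cast hcard
    _ = 2 * (((N / v₂ : ℤ) : ℝ) + 1) := by
      rw [Nat.cast_mul, h9, show (2 - 0 : ℤ).toNat = 2 from rfl, Nat.cast_two]
    _ ≤ _ := by
      gcongr
      rw [le_div_iff₀ (by exact_mod_cast h₂)]
      exact_mod_cast Int.ediv_mul_le N h₂.ne'

/-- The number of solutions of `n₁ u₁ ≡ n₂ u₂ (mod q)` in `M < n₁, n₂ ≤ M + N`. -/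
noncomputable def congPairCount (q : ℕ) (M N : ℤ) (u₁ u₂ : ℕ) : ℕ :=
  ((Finset.Ioc M (M + N) ×ˢ Finset.Ioc M (M + N)).filter fun x =>
    x.1 * (u₁ : ℤ) ≡ x.2 * (u₂ : ℤ) [ZMOD (q : ℤ)]).card

theorem congPairCount_comm (q : ℕ) (M N : ℤ) (u₁ u₂ : ℕ) :
    congPairCount q M N u₁ u₂ = congPairCount q M N u₂ u₁ := by
  refine Finset.card_bij' (fun x _ => x.swap) (fun x _ => x.swap) ?_ ?_
    (fun _ _ => rfl) (fun _ _ => rfl)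
  all_goals
    rintro ⟨a, b⟩ h
    simp only [Finset.mem_filter, Finset.mem_product, Prod.swap] at h ⊢
    exact ⟨h.1.symm, h.2.symm⟩

theorem congPairCount_le_of_lt {q : ℕ} {M N : ℤ} {u₁ u₂ : ℕ} (hq : q.Prime) (hN : 0 < N)
    (h₁ : 0 < u₁) (h₁₂ : u₁ < u₂) (hqN : u₂ * N ≤ q) :
    (congPairCount q M N u₁ u₂ : ℝ) ≤ 2 * (N * ((Nat.gcd u₁ u₂ : ℝ) / u₂) + 1) := by
  have hg : 0 < Nat.gcd u₁ u₂ := Nat.gcd_pos_of_pos_left _ h₁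
  obtain ⟨a, b, hab, ha, hb⟩ := Nat.exists_coprime u₁ u₂
  set g := Nat.gcd u₁ u₂
  have hgu : g < u₂ := (Nat.gcd_le_left _ h₁).trans_lt h₁₂
  have hu₂q : (u₂ : ℤ) ≤ q := by nlinarith
  have hndvd : ¬ (q : ℤ) ∣ g := by
    intro h
    have := Nat.le_of_dvd hg (by exact_mod_cast h)
    omega
  have ha0 : 0 < a := Nat.pos_of_mul_pos_right (ha ▸ h₁)
  have hab' : a < b := by
    rw [ha, hb] at h₁₂
    exact Nat.lt_of_mul_lt_mul_right h₁₂
  have hb0 : 0 < b := ha0.trans hab'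
  have hbu : b ≤ u₂ := by rw [hb]; exact Nat.le_mul_of_pos_right _ hg
  have hbN : (b : ℤ) * N ≤ q := by
    have : (b : ℤ) ≤ u₂ := by exact_mod_cast hbu
    nlinarith
  have hmain := card_filter_dvd_linear_le (M := M) (q := q) (v₁ := a) (v₂ := b)
    (by exact_mod_cast hq.pos) hN (by exact_mod_cast ha0) (by exact_mod_cast hab'.le)
    (Nat.isCoprime_iff_coprime.2 hab) hbN
  have e : (g : ℝ) / u₂ = 1 / b := by
    have hg' : (g : ℝ) ≠ 0 := by exact_mod_cast hg.ne'
    have hb' : (b : ℝ) ≠ 0 := by exact_mod_cast hb0.ne'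
    have : (u₂ : ℝ) = b * g := by exact_mod_cast hb
    rw [this]
    field_simp
  rw [e, mul_one_div]
  refine le_trans ?_ (by simpa using hmain)
  unfold congPairCount
  refine Nat.cast_le.2 (Finset.card_le_card fun x hx => ?_)
  rw [Finset.mem_filter] at hx ⊢
  refine ⟨hx.1, ?_⟩
  have h := Int.modEq_iff_dvd.1 hx.2.symm
  have e2 : x.1 * (u₁ : ℤ) - x.2 * u₂ = g * (a * x.1 - b * x.2) := by
    have h1 : (u₁ : ℤ) = a * g := by exact_mod_cast ha
    have h2 : (u₂ : ℤ) = b * g := by exact_mod_cast hb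
    rw [h1, h2]
    ring
  rw [e2] at h
  exact ((Nat.prime_iff_prime_int.1 hq).dvd_or_dvd h).resolve_left hndvd

theorem congPairCount_self_le {q : ℕ} {M N : ℤ} {u : ℕ} (hq : q.Prime) (hN : 0 < N)
    (hu : 0 < u) (huq : u < q) (hNq : N ≤ q) :
    (congPairCount q M N u u : ℝ) ≤ N := by
  have h : congPairCount q M N u u ≤ (Finset.Ioc M (M + N)).card := by
    refine Finset.card_le_card_of_injOn Prod.fst ?_ ?_
    · rintro ⟨a, b⟩ hx
      simp only [Finset.coe_filter, Finset.mem_product, Set.mem_ofPred_eq] at hx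
      exact hx.1.1
    · have key : ∀ a b : ℤ, a ∈ Finset.Ioc M (M + N) → b ∈ Finset.Ioc M (M + N) →
          a * (u : ℤ) ≡ b * (u : ℤ) [ZMOD (q : ℤ)] → a = b := by
        intro a b ha hb hab
        rw [Finset.mem_Ioc] at ha hb
        have hd := Int.modEq_iff_dvd.1 hab
        rw [← sub_mul] at hd
        rcases (Nat.prime_iff_prime_int.1 hq).dvd_or_dvd hd with h | h
        · have := Int.eq_zero_of_abs_lt_dvd h (by rw [abs_lt]; omega)
          omega
        · have := Nat.le_of_dvd hu (by exact_mod_cast h)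
          omega
      rintro ⟨a, b⟩ hx ⟨c, d⟩ hy heq
      simp only [Finset.coe_filter, Finset.mem_product, Set.mem_ofPred_eq] at hx hy heq
      have h1 := key a b hx.1.1 hx.1.2 hx.2
      have h2 := key c d hy.1.1 hy.1.2 hy.2
      rw [← h1, ← h2, heq]
  rw [Int.card_Ioc, add_sub_cancel_left] at h
  calc (congPairCount q M N u u : ℝ) ≤ (N.toNat : ℝ) := by exact_mod_cast h
    _ = N := by rw [← Int.cast_natCast, Int.toNat_of_nonneg hN.le]

theorem sum_congPairCount_le {q : ℕ} {M N : ℤ} {U : ℕ} (hq : q.Prime) (hU : 2 ≤ U)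
    (hUN : (U : ℤ) ≤ N) (hqN : U * N ≤ (q : ℤ)) {R : Finset ℕ} (hR : ∀ u ∈ R, 1 ≤ u ∧ u ≤ U) :
    ((∑ y ∈ R ×ˢ R, congPairCount q M N y.1 y.2 : ℕ) : ℝ) ≤
      N * R.card * 3 +
        4 * N * ∑ y ∈ (R ×ˢ R).filter (fun y => y.1 < y.2), (Nat.gcd y.1 y.2 : ℝ) / y.2 := by
  have hN : 0 < N := by omega
  have hN0 : (0 : ℝ) < N := by exact_mod_cast hN
  set F : ℕ × ℕ → ℝ := fun y => if y.1 < y.2 then (Nat.gcd y.1 y.2 : ℝ) / y.2 else 0 with hF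
  have hF0 : ∀ y, 0 ≤ F y := fun y => by
    simp only [hF]
    split_ifs <;> positivity
  have hNq : N ≤ q := by nlinarith
  have hUq : U < q := by
    have : (U : ℤ) < q := by nlinarith
    exact_mod_cast this
  have hbound : ∀ y ∈ R ×ˢ R, (congPairCount q M N y.1 y.2 : ℝ) ≤
      (if y.1 = y.2 then (N : ℝ) else 0) + 2 + 2 * N * (F y + F y.swap) := by
    rintro ⟨a, b⟩ hy
    obtain ⟨ha, hb⟩ := Finset.mem_product.1 hy
    have ha' := hR a ha
    have hb' := hR b hb
    have hle : ∀ u : ℕ, u ≤ U → u * N ≤ (q : ℤ) := fun u hu => by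
      have : (u : ℤ) ≤ U := by exact_mod_cast hu
      nlinarith
    rcases lt_trichotomy a b with h | rfl | h
    · have := congPairCount_le_of_lt (M := M) hq hN ha'.1 h (hle b hb'.2)
      simp only [hF, Prod.swap, h, h.ne, h.not_gt, if_true, if_false]
      linarith
    · have := congPairCount_self_le (M := M) hq hN ha'.1 (ha'.2.trans_lt hUq) hNq
      simp only [hF, Prod.swap, lt_irrefl, if_true, if_false]
      linarith
    · have := congPairCount_le_of_lt (M := M) hq hN hb'.1 h (hle a ha'.2)
      rw [congPairCount_comm] at this
      simp only [hF, Prod.swap, h, h.ne', h.not_gt, if_true, if_false]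
      linarith
  have hswap : ∑ y ∈ R ×ˢ R, F y.swap = ∑ y ∈ R ×ˢ R, F y := by
    rw [Finset.sum_product, Finset.sum_product_right]
    rfl
  have hdiag : ∑ y ∈ R ×ˢ R, (if y.1 = y.2 then (N : ℝ) else 0) = N * R.card := by
    rw [Finset.sum_product]
    calc ∑ a ∈ R, ∑ b ∈ R, (if a = b then (N : ℝ) else 0) = ∑ _a ∈ R, (N : ℝ) := by
          refine Finset.sum_congr rfl fun a ha => ?_
          rw [Finset.sum_ite_eq, if_pos ha]
      _ = _ := by rw [Finset.sum_const, nsmul_eq_mul, mul_comm]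
  have hcard : (R.card : ℝ) ≤ N := by
    have h1 : R.card ≤ U := by
      have : R ⊆ Finset.Icc 1 U := fun u hu => Finset.mem_Icc.2 (hR u hu)
      simpa using Finset.card_le_card this
    have h2 : (R.card : ℤ) ≤ N := by omega
    exact_mod_cast h2
  rw [Nat.cast_sum]
  calc ∑ y ∈ R ×ˢ R, (congPairCount q M N y.1 y.2 : ℝ)
      ≤ ∑ y ∈ R ×ˢ R,
          ((if y.1 = y.2 then (N : ℝ) else 0) + 2 + 2 * N * (F y + F y.swap)) :=
        Finset.sum_le_sum hbound
    _ = N * R.card + R.card * R.card * 2 + 2 * N * (2 * ∑ y ∈ R ×ˢ R, F y) := by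
        rw [Finset.sum_add_distrib, Finset.sum_add_distrib, hdiag, ← Finset.mul_sum,
          Finset.sum_add_distrib, hswap, Finset.sum_const, Finset.card_product, nsmul_eq_mul]
        push_cast
        ring
    _ ≤ N * R.card + N * R.card * 2 + 2 * N * (2 * ∑ y ∈ R ×ˢ R, F y) := by gcongr
    _ = _ := by rw [Finset.sum_filter]; ring

theorem multCongCount_eq_sum (q : ℕ) (z : ℝ) (M N U : ℤ) :
    multCongCount q z M N U =
      ∑ y ∈ roughNumbers z (U : ℝ) ×ˢ roughNumbers z (U : ℝ), congPairCount q M N y.1 y.2 := by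
  rw [multCongCount, Finset.card_filter, Finset.sum_product_right]
  refine Finset.sum_congr rfl fun y _ => ?_
  rw [congPairCount, Finset.card_filter]

theorem roughNumbers_eq_roughUpTo (z : ℝ) (U : ℕ) :
    roughNumbers z (U : ℝ) = roughUpTo ⌈z⌉₊ U := by
  ext u
  rw [mem_roughNumbers, mem_roughUpTo, Nat.cast_le]
  refine and_congr_right fun _ => ?_
  rw [← Nat.coprime_iff_gcd_eq_one, primeProdBelow, Nat.coprime_prod_right_iff]
  refine ⟨fun h p hp hd => ?_, fun h p hp => ?_⟩
  · by_contra! hlt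
    have := h p (Finset.mem_filter.2 ⟨Finset.mem_range.2 hlt, hp⟩)
    exact (hp.coprime_iff_not_dvd.1 this.symm) hd
  · obtain ⟨h1, h2⟩ := Finset.mem_filter.1 hp
    refine (h2.coprime_iff_not_dvd.2 fun hd => ?_).symm
    have := h p h2 hd
    have := Finset.mem_range.1 h1
    omega

theorem roughNumbers_eq_empty {z U : ℝ} (hU : U ≤ 0) : roughNumbers z U = ∅ := by
  rw [roughNumbers, Nat.floor_of_nonpos hU]
  rfl

theorem lemma4p1 :
    ∃ A₀ : ℝ, 0 < A₀ ∧ A₀ < 1 / 2 ∧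
      ∀ A : ℝ, 0 < A → A ≤ A₀ →
        ∃ C : ℝ, 0 < C ∧
          ∀ (q : ℕ) (z : ℝ) (M N U : ℤ), q.Prime →
            U ≤ N → U * N ≤ (q : ℤ) →
            1 < z → z ≤ (U : ℝ) ^ A →
            (multCongCount q z M N U : ℝ) ≤
              C * ((N : ℝ) * ((roughNumbers z (U : ℝ)).card : ℝ) *
                (1 + Real.log (U : ℝ) / (Real.log z) ^ 2)) := by
  obtain ⟨C, hC, h⟩ := exists_sum_gcd_div_le
  refine ⟨1 / 4, by norm_num, by norm_num, fun A hA hA4 =>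
    ⟨3 + 4 * C, by positivity, fun q z M N U hq hUN hqN hz hzU => ?_⟩⟩
  rw [multCongCount_eq_sum]
  rcases le_or_gt U 0 with hU | hU
  · rw [roughNumbers_eq_empty (by exact_mod_cast hU)]
    simp
  lift U to ℕ using hU.le
  rw [Int.cast_natCast] at hzU ⊢
  have hU2 : 2 ≤ U := by
    by_contra! hlt
    have : U = 1 := by omega
    rw [this, Nat.cast_one, Real.one_rpow] at hzU
    linarith
  have hU1 : (1 : ℝ) ≤ U := by exact_mod_cast (by omega : 1 ≤ U)
  rw [roughNumbers_eq_roughUpTo]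
  set k := ⌈z⌉₊
  have hk2 : 2 ≤ k := Nat.lt_ceil.2 (by simpa using hz)
  have hz4 : z ≤ (U : ℝ) ^ (1 / 4 : ℝ) :=
    hzU.trans (Real.rpow_le_rpow_of_exponent_le hU1 hA4)
  have hkU : k ≤ U := Nat.ceil_le.2 (hzU.trans (Real.rpow_le_self_of_one_le hU1 (by linarith)))
  have hk4 : (k : ℝ) ≤ (U : ℝ) ^ (1 / 4 : ℝ) + 1 := by
    have := Nat.ceil_lt_add_one (a := z) (by linarith)
    linarith
  have hgcd := h k U hk2 hkU hk4
  have hlogz : 0 < Real.log z := Real.log_pos hz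
  have hlogzk : Real.log z ≤ Real.log k := Real.log_le_log (by linarith) (Nat.le_ceil z)
  have hlogU : 0 ≤ Real.log U := Real.log_natCast_nonneg U
  have hN : (0 : ℝ) < N := by exact_mod_cast (by omega : 0 < N)
  set T := Real.log U / Real.log z ^ 2
  have hT : Real.log U / Real.log k ^ 2 ≤ T := by simp only [T]; gcongr
  have hT0 : 0 ≤ T := by positivity
  set R := (roughUpTo k U).card
  have hmain := sum_congPairCount_le (M := M) hq hU2 hUN hqN
    (R := roughUpTo k U) fun u hu => (mem_roughUpTo.1 hu).1
  calc _ ≤ _ := hmain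
    _ ≤ N * R * 3 + 4 * N * (C * (R * T)) := by
        gcongr
        refine hgcd.trans ?_
        gcongr
    _ ≤ _ := by
        have h1 : 0 ≤ (N : ℝ) * R * T := by positivity
        have h2 : 0 ≤ (N : ℝ) * R := by positivity
        have h3 : 0 ≤ C * ((N : ℝ) * R) := by positivity
        nlinarith
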